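/- Let $K$ be a field and let $C$ be a (coassociative, counital) coalgebra over $K$ with comultiplication $\Delta$. Its dual $C^*=\mathrm{Hom}_K(C,K)$ is an algebra under the convolution product $(fg)(c)=\sum f(c_1)g(c_2)$, where $\Delta(c)=\sum c_1\otimes c_2$, with the counit as identity. A subcoalgebra of $C$ is a subspace $D$ with $\Delta(D)\subseteq D\otimes D$. For a subspace $W\subseteq C$ put $W^\perp=\{f\in C^* : f(w)=0 \text{ for all } w\in W\}$, and let $W^\perp W^\perp$ be the linear span of the products $fg$ with $f,g\in W^\perp$. The finite dual of a $K$-algebra $A$ is $A^0=\{\varphi\in A^* : \ker\varphi \text{ contains a two-sided ideal of } A \text{ of finite codimension}\}$, and $C$ is called coreflexive if the natural map $C\to (C^*)^0$, $c\mapsto (f\mapsto f(c))$, is an isomorphism. The coradical $C_0$ of $C$ is the sum of all simple subcoalgebras of $C$ (the nonzero subcoalgebras whose only subcoalgebras are $0$ and themselves); it is a subcoalgebra, hence itself a coalgebra. Theorem. Suppose that for every finite-dimensional subcoalgebra $V$ of $C$ there is a finite-dimensional subcoalgebra $W$ of $C$ with $V\subseteq W$ and $W^\perp W^\perp=W^\perp$.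 Then $C$ is coreflexive if and only if its coradical $C_0$ is coreflexive. -/

import Mathlib

open scoped TensorProduct

namespace Submodule

variable {K C : Type*} [Field K] [AddCommGroup C] [Module K C] [Coalgebra K C]

/-- A subspace `D` of a coalgebra `C` is a *subcoalgebra* if `Δ(D) ⊆ D ⊗ D`, where `D ⊗ D` is
identified with its image in `C ⊗ C`. -/
class IsSubcoalgebra (D : Submodule K C) : Prop where
  comul_mem : ∀ ⦃x : C⦄, x ∈ D →
    (Coalgebra.comul x : C ⊗[K] C) ∈ LinearMap.range (TensorProduct.mapIncl D D)

theorem mapIncl_injective {K C : Type*} [Field K] [AddCommGroup C] [Module K C]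
    (D : Submodule K C) :
    Function.Injective (TensorProduct.mapIncl D D) :=
  TensorProduct.map_injective_of_flat_flat _ _ D.injective_subtype D.injective_subtype

/-- The comultiplication of a subcoalgebra, obtained by restricting that of `C`. -/
noncomputable def subComul (D : Submodule K C) [D.IsSubcoalgebra] : D →ₗ[K] D ⊗[K] D :=
  (LinearEquiv.ofInjective (TensorProduct.mapIncl D D) D.mapIncl_injective).symm.toLinearMap ∘ₗ
    LinearMap.codRestrict (LinearMap.range (TensorProduct.mapIncl D D))
      ((Coalgebra.comul : C →ₗ[K] C ⊗[K] C) ∘ₗ D.subtype)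
      (fun x => IsSubcoalgebra.comul_mem x.2)

theorem mapIncl_subComul (D : Submodule K C) [D.IsSubcoalgebra] (x : D) :
    TensorProduct.mapIncl D D (D.subComul x) = Coalgebra.comul (x : C) := by
  have h := LinearEquiv.apply_symm_apply
    (LinearEquiv.ofInjective (TensorProduct.mapIncl D D) D.mapIncl_injective)
    (LinearMap.codRestrict (LinearMap.range (TensorProduct.mapIncl D D))
      ((Coalgebra.comul : C →ₗ[K] C ⊗[K] C) ∘ₗ D.subtype)
      (fun x => IsSubcoalgebra.comul_mem x.2) x)
  exact congrArg Subtype.val h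

/-- The restricted comultiplication and counit on a subcoalgebra. -/
noncomputable instance instCoalgebraStructSub (D : Submodule K C) [D.IsSubcoalgebra] :
    CoalgebraStruct K D where
  comul := D.subComul
  counit := (Coalgebra.counit : C →ₗ[K] K) ∘ₗ D.subtype

/-- A subcoalgebra is a coalgebra. -/
noncomputable instance instCoalgebraSub (D : Submodule K C) [D.IsSubcoalgebra] :
    Coalgebra K D where
  coassoc := by
    have hinj : Function.Injective
        (TensorProduct.map D.subtype (TensorProduct.map D.subtype D.subtype)) :=
      TensorProduct.map_injective_of_flat_flat _ _ D.injective_subtype D.mapIncl_injective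
    have key : ∀ z : D ⊗[K] D,
        TensorProduct.map D.subtype (TensorProduct.map D.subtype D.subtype)
          (TensorProduct.assoc K D D D (LinearMap.rTensor D D.subComul z)) =
        TensorProduct.assoc K C C C (LinearMap.rTensor C Coalgebra.comul
          (TensorProduct.map D.subtype D.subtype z)) := by
      intro z
      induction z with
      | zero => simp
      | add z w hz hw => simp only [map_add, hz, hw]
      | tmul x y =>
        have h := LinearMap.congr_fun (TensorProduct.map_map_comp_assoc_eq
          D.subtype D.subtype D.subtype) (D.subComul x ⊗ₜ[K] y)
        have hx := D.mapIncl_subComul x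
        simp only [TensorProduct.mapIncl] at hx
        simpa [hx] using h
    have key' : ∀ z : D ⊗[K] D,
        TensorProduct.map D.subtype (TensorProduct.map D.subtype D.subtype)
          (LinearMap.lTensor D D.subComul z) =
        LinearMap.lTensor C Coalgebra.comul (TensorProduct.map D.subtype D.subtype z) := by
      intro z
      induction z with
      | zero => simp
      | add z w hz hw => simp only [map_add, hz, hw]
      | tmul x y =>
        have hy := D.mapIncl_subComul y
        simp only [TensorProduct.mapIncl] at hy
        simp [hy]
    refine LinearMap.ext fun x => hinj ?_
    have hx : TensorProduct.map D.subtype D.subtype (D.subComul x) = Coalgebra.comul (x : C) :=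
      D.mapIncl_subComul x
    have h := Coalgebra.coassoc_apply (R := K) (x : C)
    rw [← hx] at h
    exact (key _).trans (h.trans (key' _).symm)
  rTensor_counit_comp_comul := by
    have hinj : Function.Injective (LinearMap.lTensor K D.subtype) :=
      Module.Flat.lTensor_preserves_injective_linearMap _ D.injective_subtype
    refine LinearMap.ext fun x => hinj ?_
    have hx : TensorProduct.map D.subtype D.subtype (D.subComul x) = Coalgebra.comul (x : C) :=
      D.mapIncl_subComul x
    have key : LinearMap.lTensor K D.subtype ∘ₗ
        LinearMap.rTensor D ((Coalgebra.counit : C →ₗ[K] K) ∘ₗ D.subtype) =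
        LinearMap.rTensor C (Coalgebra.counit : C →ₗ[K] K) ∘ₗ
          TensorProduct.map D.subtype D.subtype := by
      ext; simp
    refine (LinearMap.congr_fun key (D.subComul x)).trans ?_
    rw [LinearMap.comp_apply, hx, Coalgebra.rTensor_counit_comul]
    simp
  lTensor_counit_comp_comul := by
    have hinj : Function.Injective (LinearMap.rTensor K D.subtype) :=
      Module.Flat.rTensor_preserves_injective_linearMap _ D.injective_subtype
    refine LinearMap.ext fun x => hinj ?_
    have hx : TensorProduct.map D.subtype D.subtype (D.subComul x) = Coalgebra.comul (x : C) :=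
      D.mapIncl_subComul x
    have key : LinearMap.rTensor K D.subtype ∘ₗ
        LinearMap.lTensor D ((Coalgebra.counit : C →ₗ[K] K) ∘ₗ D.subtype) =
        LinearMap.lTensor C (Coalgebra.counit : C →ₗ[K] K) ∘ₗ
          TensorProduct.map D.subtype D.subtype := by
      ext; simp
    refine (LinearMap.congr_fun key (D.subComul x)).trans ?_
    rw [LinearMap.comp_apply, hx, Coalgebra.lTensor_counit_comul]
    simp

theorem isSubcoalgebra_sSup (S : Set (Submodule K C)) (hS : ∀ D ∈ S, D.IsSubcoalgebra) :
    (sSup S).IsSubcoalgebra where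
  comul_mem := by
    have key : sSup S ≤ (LinearMap.range (TensorProduct.mapIncl (sSup S) (sSup S))).comap
        (Coalgebra.comul : C →ₗ[K] C ⊗[K] C) := by
      refine sSup_le fun D hD x hx => ?_
      exact TensorProduct.range_mapIncl_mono (le_sSup hD) (le_sSup hD) ((hS D hD).comul_mem hx)
    exact fun x hx => key hx

end Submodule

namespace Coalgebra

/-- The dual algebra `C^*` of a coalgebra `C`: all linear forms on `C` with the convolution
product `(f * g)(c) = ∑ f(c₁) g(c₂)` and with unit the counit of `C`. -/
abbrev DualAlgebra (K C : Type*) [Field K] [AddCommGroup C] [Module K C] [Coalgebra K C] :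
    Type _ :=
  WithConv (C →ₗ[K] K)

/-- The finite dual `A^0` of an algebra `A`: the linear forms on `A` whose kernel contains
a two-sided ideal of finite codimension. -/
def finiteDual (K A : Type*) [Field K] [Ring A] [Algebra K A] :
    Submodule K (Module.Dual K A) where
  carrier := {f | ∃ I : Ideal A, I.IsTwoSided ∧ FiniteDimensional K (A ⧸ I) ∧
    ∀ a ∈ I, f a = 0}
  zero_mem' := ⟨⊤, inferInstance, inferInstance, fun _ _ => rfl⟩
  add_mem' := by
    rintro f g ⟨I, hI, hI', hf⟩ ⟨J, hJ, hJ', hg⟩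
    refine ⟨I ⊓ J, ⟨fun b ha => ⟨I.mul_mem_right b ha.1, J.mul_mem_right b ha.2⟩⟩, ?_,
      fun a ha => ?_⟩
    · let φ : (A ⧸ (I ⊓ J : Ideal A)) →ₗ[A] (A ⧸ I) × (A ⧸ J) :=
        Submodule.liftQ _ (I.mkQ.prod J.mkQ) (by rw [LinearMap.ker_prod]; simp)
      have hφ : Function.Injective φ := by
        rw [← LinearMap.ker_eq_bot]
        exact Submodule.ker_liftQ_eq_bot _ _ _ (by rw [LinearMap.ker_prod]; simp)
      exact Module.Finite.of_injective (φ.restrictScalars K) hφ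
    · simp [hf a ha.1, hg a ha.2]
  smul_mem' := by
    rintro c f ⟨I, hI, hI', hf⟩
    exact ⟨I, hI, hI', fun a ha => by simp [hf a ha]⟩

variable (K C : Type*) [Field K] [AddCommGroup C] [Module K C] [Coalgebra K C]

/-- The natural map `C → (C^*)^*` sending `c` to the evaluation `f ↦ f(c)`. -/
def evalDual : C →ₗ[K] Module.Dual K (DualAlgebra K C) where
  toFun c :=
    { toFun := fun f => f.ofConv c
      map_add' := fun _ _ => rfl
      map_smul' := fun _ _ => rfl }
  map_add' c d := LinearMap.ext fun f => map_add f.ofConv c d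
  map_smul' a c := LinearMap.ext fun f => map_smul f.ofConv a c

@[simp]
theorem evalDual_apply (c : C) (f : DualAlgebra K C) : evalDual K C c f = f.ofConv c := rfl

/-- `C` is *coreflexive* if the natural map `c ↦ (f ↦ f(c))` is an isomorphism of `C` onto the
finite dual `(C^*)^0` of its dual algebra. -/
def IsCoreflexive : Prop :=
  Set.BijOn (evalDual K C) Set.univ (finiteDual K (DualAlgebra K C))

variable {K C}

/-- A *simple* subcoalgebra: it is nonzero, and `0` and itself are its only subcoalgebras. -/
structure IsSimpleSubcoalgebra (D : Submodule K C) : Prop where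
  isSubcoalgebra : D.IsSubcoalgebra
  ne_bot : D ≠ ⊥
  eq_bot_or_eq : ∀ E : Submodule K C, E.IsSubcoalgebra → E ≤ D → E = ⊥ ∨ E = D

variable (K C)

/-- The *coradical* `C_0`: the sum of all simple subcoalgebras of `C`. -/
def coradical : Submodule K C :=
  sSup {D : Submodule K C | IsSimpleSubcoalgebra D}

instance instIsSubcoalgebraCoradical : (coradical K C).IsSubcoalgebra :=
  Submodule.isSubcoalgebra_sSup _ fun _ hD => hD.isSubcoalgebra

variable {K C}

/-- The orthogonal `W^⊥` in `C^*` of a subspace `W` of `C`: the forms that vanish on `W`. -/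
def perp (W : Submodule K C) : Submodule K (DualAlgebra K C) where
  carrier := {f | ∀ w ∈ W, f.ofConv w = 0}
  zero_mem' := fun _ _ => rfl
  add_mem' := by
    intro f g hf hg w hw
    change f.ofConv w + g.ofConv w = 0
    rw [hf w hw, hg w hw, add_zero]
  smul_mem' := by
    intro a f hf w hw
    change a • f.ofConv w = 0
    rw [hf w hw, smul_zero]

end Coalgebra

/-! Write A = C^* and J = C_0^⊥. Coreflexivity passes to any subcoalgebra D: pull a form back along
the restriction A → D^*; the representing element lies in D because D^⊥ is killed.

Conversely, let φ vanish on a cofinite two-sided ideal I, and put P = I + J. Since P contains J,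
coreflexivity of C_0 makes every form killing P an evaluation, so P = E^⊥ for a finite-dimensional
subcoalgebra E. Take W ⊇ E with W^⊥ idempotent. Then W^⊥ ⊆ I + J. The key fact is that 1 + f is left
invertible in A for f in J (`exists_mul_one_add_eq_one`), so J maps into the Jacobson radical of
A/I, which is nilpotent. An idempotent subspace with nilpotent image is zero modulo I, so W^⊥ ⊆ I
(`perp_le_of_mul_self_eq`). Thus φ kills W^⊥ and is evaluation at an element of W. -/

namespace TensorProduct

/-! ### Preliminaries on tensors and semisimple quotients -/

theorem eq_zero_of_forall_mul'_map {K V W : Type*} [Field K] [AddCommGroup V] [Module K V]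
    [AddCommGroup W] [Module K W] (z : V ⊗[K] W)
    (h : ∀ (f : V →ₗ[K] K) (g : W →ₗ[K] K), LinearMap.mul' K K (map f g z) = 0) : z = 0 := by
  let b := Module.Basis.ofVectorSpace K V
  let b' := Module.Basis.ofVectorSpace K W
  refine (b.tensorProduct b').ext_elem fun ⟨i, j⟩ => ?_
  have key : (b.tensorProduct b').coord (i, j) =
      LinearMap.mul' K K ∘ₗ map (b.coord i) (b'.coord j) := by
    refine TensorProduct.ext' fun x y => ?_
    simp [mul_comm]
  have := LinearMap.congr_fun key z
  rw [LinearMap.comp_apply, h, Module.Basis.coord_apply] at this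
  simp [this]

end TensorProduct

/-- Let N be the right annihilator of J modulo ker π. Split 1 = e + k along the left ideal π(J) and
a complement L. For i in π(J), ik = i - ie lies in π(J) ∩ L = 0, so lifts of k lie in N and J + N
contains 1. Hence N cannot be proper, and 1 ∈ N gives π(J) = 0. -/
theorem Ideal.le_ker_of_forall_sup_ne_top {A R : Type*} [Ring A] [Ring R] [IsSemisimpleRing R]
    {π : A →+* R} (hπ : Function.Surjective π) (J : Ideal A) [J.IsTwoSided]
    (h : ∀ N : Ideal A, N.IsTwoSided → RingHom.ker π ≤ N → N ≠ ⊤ → J ⊔ N ≠ ⊤) :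
    J ≤ RingHom.ker π := by
  let N : Ideal A :=
    { carrier := {a | ∀ j ∈ J, π (j * a) = 0}
      zero_mem' := fun j _ => by simp
      add_mem' := fun {a b} ha hb j hj => by rw [mul_add, map_add, ha j hj, hb j hj, add_zero]
      smul_mem' := fun b a ha j hj => by
        rw [smul_eq_mul, ← mul_assoc]
        exact ha _ (J.mul_mem_right b hj) }
  have hN : N.IsTwoSided :=
    ⟨fun {a} b ha j hj => by rw [← mul_assoc, map_mul, ha j hj, zero_mul]⟩
  have hker : RingHom.ker π ≤ N := fun a ha j _ => by
    rw [map_mul, (RingHom.mem_ker).1 ha, mul_zero]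
  have htop : N = ⊤ := by
    by_contra hne
    refine h N hN hker hne ((Ideal.eq_top_iff_one _).2 ?_)
    obtain ⟨L, hL⟩ := exists_isCompl (J.map π)
    have h1 : (1 : R) ∈ J.map π ⊔ L := by rw [hL.sup_eq_top]; trivial
    obtain ⟨e, he, k, hk, hek⟩ := Submodule.mem_sup.1 h1
    obtain ⟨j, hj, rfl⟩ := (Ideal.mem_map_iff_of_surjective π hπ).1 he
    obtain ⟨a, rfl⟩ := hπ k
    have ha : a ∈ N := fun i hi => by
      have hi' := Ideal.mem_map_of_mem π hi
      have h2 : π (i * a) = π i - π i * π j := by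
        rw [map_mul, eq_sub_of_add_eq' hek, mul_sub, mul_one]
      have h3 : π (i * a) ∈ J.map π := by
        rw [h2]
        exact sub_mem hi' (Ideal.mul_mem_left _ _ he)
      have h4 : π (i * a) ∈ L := by
        rw [map_mul]
        exact L.mul_mem_left _ hk
      exact (Submodule.disjoint_def.1 hL.disjoint) _ h3 h4
    have h5 : 1 - (j + a) ∈ N := hker (by
      rw [RingHom.mem_ker, map_sub, map_add, hek, map_one, sub_self])
    have h6 : (1 : A) = j + (a + (1 - (j + a))) := by abel
    rw [h6]
    exact Submodule.add_mem_sup hj (N.add_mem ha h5)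
  intro j hj
  have h1 : (1 : A) ∈ N := by rw [htop]; trivial
  rw [RingHom.mem_ker, ← h1 j hj, mul_one]

theorem Ideal.mk_mem_jacobson_of_forall_sup_ne_top {A : Type*} [Ring A] {P J : Ideal A}
    [P.IsTwoSided] [J.IsTwoSided] [IsArtinianRing (A ⧸ P)]
    (h : ∀ N : Ideal A, N.IsTwoSided → P ≤ N → N ≠ ⊤ → J ⊔ N ≠ ⊤) {f : A} (hf : f ∈ J) :
    Ideal.Quotient.mk P f ∈ Ring.jacobson (A ⧸ P) := by
  let π := (Ideal.Quotient.mk (Ring.jacobson (A ⧸ P))).comp (Ideal.Quotient.mk P)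
  have hπ : Function.Surjective π :=
    Ideal.Quotient.mk_surjective.comp Ideal.Quotient.mk_surjective
  have hker : J ≤ RingHom.ker π := by
    refine Ideal.le_ker_of_forall_sup_ne_top hπ J fun N hN hle => h N hN fun g hg => hle ?_
    rw [RingHom.mem_ker, RingHom.comp_apply, Ideal.Quotient.eq_zero_iff_mem.2 hg, map_zero]
  exact Ideal.Quotient.eq_zero_iff_mem.1 (hker hf)

/-! ### Duality between subspaces of C and ideals of C^* -/

namespace Coalgebra

variable {K C : Type*} [Field K] [AddCommGroup C] [Module K C] [Coalgebra K C]

theorem dualAlgebra_mul_apply (f g : DualAlgebra K C) (c : C) :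
    (f * g).ofConv c =
      LinearMap.mul' K K (_root_.TensorProduct.map f.ofConv g.ofConv (comul c)) := rfl

theorem exists_mem_perp_apply_ne_zero {W : Submodule K C} {x : C} (hx : x ∉ W) :
    ∃ f ∈ perp W, f.ofConv x ≠ 0 := by
  obtain ⟨f, hfx, hf⟩ := W.exists_le_ker_of_notMem hx
  exact ⟨WithConv.toConv f, fun w hw => hf hw, hfx⟩

theorem mul_mem_perp {D : Submodule K C} (hD : D.IsSubcoalgebra) {f g : DualAlgebra K C}
    (h : f ∈ perp D ∨ g ∈ perp D) : f * g ∈ perp D := by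
  intro x hx
  obtain ⟨z, hz⟩ := hD.comul_mem hx
  rw [dualAlgebra_mul_apply, ← hz]
  clear hz
  induction z with
  | zero => simp
  | add z w hz hw => simp only [map_add, hz, hw, add_zero]
  | tmul a b =>
    rcases h with h | h
    · simp [h a a.2]
    · simp [h b b.2]

/-- The orthogonal of a subcoalgebra, as an ideal of the dual algebra. -/
def perpIdeal (D : Submodule K C) (hD : D.IsSubcoalgebra) : Ideal (DualAlgebra K C) where
  carrier := {f | f ∈ perp D}
  zero_mem' := (perp D).zero_mem
  add_mem' := (perp D).add_mem
  smul_mem' _ _ hf := mul_mem_perp hD (Or.inr hf)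

instance (D : Submodule K C) (hD : D.IsSubcoalgebra) : (perpIdeal D hD).IsTwoSided :=
  ⟨fun _ hf => mul_mem_perp hD (Or.inl hf)⟩

/-- The elements of `C` on which all forms of an ideal of `C^*` vanish. -/
def polar (P : Ideal (DualAlgebra K C)) : Submodule K C where
  carrier := {c | ∀ f ∈ P, f.ofConv c = 0}
  zero_mem' f _ := map_zero f.ofConv
  add_mem' {c d} hc hd f hf := by rw [map_add, hc f hf, hd f hf, add_zero]
  smul_mem' a c hc f hf := by rw [map_smul, hc f hf, smul_zero]

/-- Restriction of linear forms to a subspace. -/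
def restrictForm (D : Submodule K C) : DualAlgebra K C →ₗ[K] Module.Dual K D where
  toFun f := f.ofConv ∘ₗ D.subtype
  map_add' _ _ := rfl
  map_smul' _ _ := rfl

theorem restrictForm_apply (D : Submodule K C) (f : DualAlgebra K C) (d : D) :
    restrictForm D f d = f.ofConv d := rfl

theorem exists_extendForm (D : Submodule K C) :
    ∃ s : Module.Dual K D →ₗ[K] DualAlgebra K C, restrictForm D ∘ₗ s = LinearMap.id := by
  refine LinearMap.exists_rightInverse_of_surjective _ (LinearMap.range_eq_top.2 fun ψ => ?_)
  obtain ⟨f, hf⟩ := LinearMap.exists_extend ψ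
  exact ⟨WithConv.toConv f, hf⟩

theorem sub_extendForm_mem_perp {D : Submodule K C} {s : Module.Dual K D →ₗ[K] DualAlgebra K C}
    (hs : restrictForm D ∘ₗ s = LinearMap.id) (f : DualAlgebra K C) :
    f - s (restrictForm D f) ∈ perp D := by
  intro d hd
  have h := LinearMap.congr_fun (LinearMap.congr_fun hs (restrictForm D f)) ⟨d, hd⟩
  change f.ofConv d - (s (restrictForm D f)).ofConv d = 0
  rw [sub_eq_zero]
  exact h.symm

/-- The form factors through the dual of D, and a finite-dimensional space is reflexive. -/
theorem exists_evalDual_eq {D : Submodule K C} [FiniteDimensional K D]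
    {φ : Module.Dual K (DualAlgebra K C)} (hφ : ∀ f ∈ perp D, φ f = 0) :
    ∃ c, evalDual K C c = φ := by
  obtain ⟨s, hs⟩ := exists_extendForm D
  refine ⟨((Module.evalEquiv K D).symm (φ ∘ₗ s) : D), LinearMap.ext fun f => ?_⟩
  have h1 := hφ _ (sub_extendForm_mem_perp hs f)
  rw [map_sub, sub_eq_zero] at h1
  rw [h1, evalDual_apply, ← restrictForm_apply, Module.apply_evalEquiv_symm_apply]
  rfl

theorem finiteDimensional_quotient_of_forall_exists {A V : Type*} [Ring A] [Algebra K A]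
    [AddCommGroup V] [Module K V] [FiniteDimensional K V] {P : Ideal A} (l : V →ₗ[K] A)
    (h : ∀ a, ∃ v, a - l v ∈ P) : FiniteDimensional K (A ⧸ P) := by
  refine Module.Finite.of_surjective ((P.mkQ.restrictScalars K : A →ₗ[K] A ⧸ P) ∘ₗ l) fun y => ?_
  obtain ⟨a, rfl⟩ := P.mkQ_surjective y
  exact (h a).imp fun v hv => ((Submodule.Quotient.eq P).2 hv).symm

theorem exists_section_quotient {A : Type*} [Ring A] [Algebra K A] (P : Ideal A) :
    ∃ t : (A ⧸ P) →ₗ[K] A, ∀ a, a - t (P.mkQ a) ∈ P := by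
  obtain ⟨t, ht⟩ := (P.mkQ.restrictScalars K : A →ₗ[K] A ⧸ P).exists_rightInverse_of_surjective
    (LinearMap.range_eq_top.2 P.mkQ_surjective)
  exact ⟨t, fun a => (Submodule.Quotient.eq P).1 (LinearMap.congr_fun ht (P.mkQ a)).symm⟩

theorem finiteDimensional_quotient {D : Submodule K C} [FiniteDimensional K D]
    {P : Ideal (DualAlgebra K C)} (hP : ∀ f ∈ perp D, f ∈ P) :
    FiniteDimensional K (DualAlgebra K C ⧸ P) := by
  obtain ⟨s, hs⟩ := exists_extendForm D
  exact finiteDimensional_quotient_of_forall_exists s fun f =>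
    ⟨restrictForm D f, hP _ (sub_extendForm_mem_perp hs f)⟩

/-- Bipolar argument: a form separating f from P would be evaluation at a point of `polar P`, where
f vanishes. -/
theorem mem_of_forall_polar {P : Ideal (DualAlgebra K C)}
    (hP : ∀ φ : Module.Dual K (DualAlgebra K C), (∀ f ∈ P, φ f = 0) → ∃ c, evalDual K C c = φ)
    {f : DualAlgebra K C} (hf : f ∈ perp (polar P)) : f ∈ P := by
  by_contra hfP
  obtain ⟨φ, hφf, hφ⟩ := (P.restrictScalars K).exists_le_ker_of_notMem (v := f) hfP
  obtain ⟨c, rfl⟩ := hP φ fun g hg => hφ hg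
  exact hφf (hf c fun g hg => hφ hg)

theorem finiteDimensional_polar (P : Ideal (DualAlgebra K C))
    [FiniteDimensional K (DualAlgebra K C ⧸ P)] : FiniteDimensional K (polar P) := by
  obtain ⟨s, hs⟩ := exists_section_quotient (K := K) P
  let τ : polar P →ₗ[K] Module.Dual K (DualAlgebra K C ⧸ P) :=
    (Module.Dual.transpose s) ∘ₗ evalDual K C ∘ₗ (polar P).subtype
  refine Module.Finite.of_injective τ ((injective_iff_map_eq_zero τ).2 fun c hc => ?_)
  refine Subtype.ext ((Module.forall_dual_apply_eq_zero_iff K (c : C)).1 fun f => ?_)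
  let f' : DualAlgebra K C := WithConv.toConv f
  have h2 : f'.ofConv (c : C) - (s (P.mkQ f')).ofConv c = 0 := c.2 _ (hs f')
  have h3 : (s (P.mkQ f')).ofConv (c : C) = 0 := LinearMap.congr_fun hc (P.mkQ f')
  rw [h3, sub_zero] at h2
  exact h2

theorem polar_le {D : Submodule K C} {P : Ideal (DualAlgebra K C)}
    (hP : ∀ f ∈ perp D, f ∈ P) : polar P ≤ D := by
  intro c hc
  by_contra hcD
  obtain ⟨f, hf, hfc⟩ := exists_mem_perp_apply_ne_zero hcD
  exact hfc (hc f (hP f hf))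

/-- With q a projection onto E = `polar P`, each f - f ∘ q lies in E^⊥ ⊆ P. As P is a two-sided
ideal, fg and (f ∘ q)(g ∘ q) agree on E for all f, g, which forces Δx = (q ⊗ q)Δx. -/
theorem isSubcoalgebra_polar (P : Ideal (DualAlgebra K C)) [P.IsTwoSided]
    (hP : ∀ f ∈ perp (polar P), f ∈ P) : (polar P).IsSubcoalgebra where
  comul_mem := by
    intro x hx
    set E := polar P
    obtain ⟨p, hp⟩ := LinearMap.exists_leftInverse_of_injective E.subtype E.ker_subtype
    let q : C →ₗ[K] C := E.subtype ∘ₗ p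
    have hq : ∀ f : C →ₗ[K] K,
        (WithConv.toConv f - WithConv.toConv (f ∘ₗ q) : DualAlgebra K C) ∈ P := by
      refine fun f => hP _ fun w hw => ?_
      have := LinearMap.congr_fun hp ⟨w, hw⟩
      change f w - f (p w : C) = 0
      rw [sub_eq_zero]
      exact congrArg (fun e : E => f e) this.symm
    have key : comul x - _root_.TensorProduct.map q q (comul x : C ⊗[K] C) = 0 := by
      refine TensorProduct.eq_zero_of_forall_mul'_map _ fun f g => ?_
      let F : DualAlgebra K C := WithConv.toConv f
      let G : DualAlgebra K C := WithConv.toConv g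
      let F' : DualAlgebra K C := WithConv.toConv (f ∘ₗ q)
      let G' : DualAlgebra K C := WithConv.toConv (g ∘ₗ q)
      have h : (F * G).ofConv x - (F' * G').ofConv x = 0 := by
        have h1 : F * G - F' * G' ∈ P := by
          have h2 : F * G - F' * G' = (F - F') * G' + F * (G - G') := by
            rw [sub_mul, mul_sub]; abel
          rw [h2]
          exact P.add_mem (P.mul_mem_right _ (hq f)) (P.mul_mem_left _ (hq g))
        exact hx _ h1
      rw [map_sub, map_sub, _root_.TensorProduct.map_map]
      exact h
    rw [sub_eq_zero] at key
    refine ⟨_root_.TensorProduct.map p p (comul x), ?_⟩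
    rw [TensorProduct.mapIncl, TensorProduct.map_map]
    exact key.symm

/-! ### Local finiteness of coalgebras -/

/-- X is the span of the finitely many middle factors in an expression of z. For z the twice
iterated coproduct of c, it bounds the codimension of `evalIdeal K c`. -/
theorem exists_perp_le_of_tensor (z : C ⊗[K] (C ⊗[K] C)) :
    ∃ X : Submodule K C, FiniteDimensional K X ∧ ∀ f ∈ perp X, ∀ g h : C →ₗ[K] K,
      LinearMap.mul' K K (_root_.TensorProduct.map g
        (LinearMap.mul' K K ∘ₗ _root_.TensorProduct.map f.ofConv h) z) = 0 := by
  induction z with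
  | zero => exact ⟨⊥, inferInstance, fun _ _ _ _ => by simp⟩
  | add z w hz hw =>
    obtain ⟨X, hX, hXz⟩ := hz
    obtain ⟨Y, hY, hYw⟩ := hw
    refine ⟨X ⊔ Y, inferInstance, fun f hf g h => ?_⟩
    rw [map_add, map_add, hXz f (fun w hw => hf w (Submodule.mem_sup_left hw)),
      hYw f (fun w hw => hf w (Submodule.mem_sup_right hw)), add_zero]
  | tmul a z =>
    induction z with
    | zero => exact ⟨⊥, inferInstance, fun _ _ _ _ => by simp⟩
    | add z w hz hw =>
      obtain ⟨X, hX, hXz⟩ := hz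
      obtain ⟨Y, hY, hYw⟩ := hw
      refine ⟨X ⊔ Y, inferInstance, fun f hf g h => ?_⟩
      rw [TensorProduct.tmul_add, map_add, map_add,
        hXz f (fun w hw => hf w (Submodule.mem_sup_left hw)),
        hYw f (fun w hw => hf w (Submodule.mem_sup_right hw)), add_zero]
    | tmul b d =>
      refine ⟨K ∙ b, inferInstance, fun f hf g h => ?_⟩
      simp [hf b (Submodule.mem_span_singleton_self b)]

theorem mul_mul_apply (f g h : DualAlgebra K C) (c : C) :
    (g * (f * h)).ofConv c = LinearMap.mul' K K (_root_.TensorProduct.map g.ofConv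
        (LinearMap.mul' K K ∘ₗ _root_.TensorProduct.map f.ofConv h.ofConv)
        (LinearMap.lTensor C comul (comul c))) := by
  rw [dualAlgebra_mul_apply, LinearMap.lTensor, TensorProduct.map_map, LinearMap.comp_id]
  rfl

/-- The largest two-sided ideal of `C^*` on which the evaluation at `c` vanishes. -/
def evalIdeal (K : Type*) {C : Type*} [Field K] [AddCommGroup C] [Module K C]
    [Coalgebra K C] (c : C) : Ideal (DualAlgebra K C) where
  carrier := {f | ∀ g h : DualAlgebra K C, (g * (f * h)).ofConv c = 0}
  zero_mem' g h := by rw [zero_mul, mul_zero]; rfl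
  add_mem' {f f'} hf hf' g h := by
    rw [add_mul, mul_add]
    change (g * (f * h)).ofConv c + (g * (f' * h)).ofConv c = 0
    rw [hf, hf', add_zero]
  smul_mem' a f hf g h := by
    rw [smul_eq_mul, mul_assoc, ← mul_assoc g]
    exact hf _ _

instance (c : C) : (evalIdeal K c).IsTwoSided :=
  ⟨fun {f} b hf g h => by rw [mul_assoc f]; exact hf _ _⟩

theorem apply_eq_zero_of_mem_evalIdeal {c : C} {f : DualAlgebra K C} (hf : f ∈ evalIdeal K c) :
    f.ofConv c = 0 := by
  simpa using hf 1 1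

theorem exists_perp_le_evalIdeal (K : Type*) {C : Type*} [Field K] [AddCommGroup C]
    [Module K C] [Coalgebra K C] (c : C) :
    ∃ X : Submodule K C, FiniteDimensional K X ∧ ∀ f ∈ perp X, f ∈ evalIdeal K c := by
  obtain ⟨X, hX, h⟩ := exists_perp_le_of_tensor (LinearMap.lTensor C comul (comul (R := K) c))
  exact ⟨X, hX, fun f hf g k => (mul_mul_apply f g k c).trans (h f hf g.ofConv k.ofConv)⟩

theorem evalDual_mem_finiteDual (c : C) :
    evalDual K C c ∈ finiteDual K (DualAlgebra K C) := by
  obtain ⟨X, hX, h⟩ := exists_perp_le_evalIdeal K c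
  exact ⟨evalIdeal K c, inferInstance, finiteDimensional_quotient h,
    fun f hf => apply_eq_zero_of_mem_evalIdeal (c := c) (f := f) hf⟩

theorem mem_of_perp_le {X : Submodule K C} [FiniteDimensional K X] {P : Ideal (DualAlgebra K C)}
    (h : ∀ f ∈ perp X, f ∈ P) {f : DualAlgebra K C} (hf : f ∈ perp (polar P)) : f ∈ P :=
  mem_of_forall_polar (fun _ hφ => exists_evalDual_eq (D := X) fun g hg => hφ g (h g hg)) hf

/-- The fundamental theorem of coalgebras: every element lies in a finite-dimensional
subcoalgebra. -/
theorem exists_finiteDimensional_isSubcoalgebra (c : C) :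
    ∃ D : Submodule K C, D.IsSubcoalgebra ∧ FiniteDimensional K D ∧ c ∈ D := by
  obtain ⟨X, hX, h⟩ := exists_perp_le_evalIdeal K c
  exact ⟨polar (evalIdeal K c), isSubcoalgebra_polar _ fun _ hf => mem_of_perp_le h hf,
    Submodule.finiteDimensional_of_le (polar_le h),
    fun f hf => apply_eq_zero_of_mem_evalIdeal hf⟩

theorem evalDual_injective : Function.Injective (evalDual K C) := by
  refine (injective_iff_map_eq_zero _).2 fun c hc => ?_
  exact (Module.forall_dual_apply_eq_zero_iff K c).1 fun f =>
    LinearMap.congr_fun hc (WithConv.toConv f)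

theorem isCoreflexive_iff : IsCoreflexive K C ↔
    finiteDual K (DualAlgebra K C) ≤ LinearMap.range (evalDual K C) :=
  ⟨fun h _ hφ => (h.2.2 hφ).imp fun _ hc => hc.2,
    fun h => ⟨fun c _ => evalDual_mem_finiteDual c, evalDual_injective.injOn,
      fun _ hφ => (h hφ).imp fun _ hc => ⟨trivial, hc⟩⟩⟩

/-! ### The orthogonal of the coradical and the Jacobson radical -/

theorem exists_isSimpleSubcoalgebra_le {E : Submodule K C} (hE : E.IsSubcoalgebra)
    [FiniteDimensional K E] (hne : E ≠ ⊥) : ∃ F ≤ E, IsSimpleSubcoalgebra F := by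
  obtain ⟨F, ⟨hF, hF0, hFE⟩, hmin⟩ := (measure fun F : Submodule K C =>
    Module.finrank K F).wf.has_min {F | F.IsSubcoalgebra ∧ F ≠ ⊥ ∧ F ≤ E} ⟨E, hE, hne, le_rfl⟩
  have : FiniteDimensional K F := Submodule.finiteDimensional_of_le hFE
  refine ⟨F, hFE, hF, hF0, fun G hG hGF => ?_⟩
  by_contra! hcon
  exact hmin G ⟨hG, hcon.1, hGF.trans hFE⟩
    (Submodule.finrank_lt_finrank_of_lt (lt_of_le_of_ne hGF hcon.2))

theorem eq_bot_of_one_mem_perp {F : Submodule K C} (hF : F.IsSubcoalgebra)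
    (h : (1 : DualAlgebra K C) ∈ perp F) : F = ⊥ := by
  refine (Submodule.eq_bot_iff F).2 fun x hx => ?_
  by_contra hx0
  obtain ⟨f, -, hf⟩ := exists_mem_perp_apply_ne_zero (K := K) (W := ⊥) (x := x) (by simpa using hx0)
  have := mul_mem_perp hF (f := f) (Or.inr h)
  rw [mul_one] at this
  exact hf (this x hx)

/-- The orthogonal of the coradical. -/
abbrev coradicalPerp (K C : Type*) [Field K] [AddCommGroup C] [Module K C] [Coalgebra K C] :
    Ideal (DualAlgebra K C) :=
  perpIdeal (coradical K C) inferInstance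

/-- A proper N has nonzero polar, which contains a simple subcoalgebra F. Both ideals vanish on F,
so their sum cannot contain 1. -/
theorem coradicalPerp_sup_ne_top {D : Submodule K C} [FiniteDimensional K D]
    {N : Ideal (DualAlgebra K C)} [N.IsTwoSided] (hDN : ∀ f ∈ perp D, f ∈ N) (hN : N ≠ ⊤) :
    coradicalPerp K C ⊔ N ≠ ⊤ := by
  intro htop
  have hclosed : ∀ f ∈ perp (polar N), f ∈ N := fun _ hf => mem_of_perp_le hDN hf
  have hE := isSubcoalgebra_polar N hclosed
  have : FiniteDimensional K (polar N) := Submodule.finiteDimensional_of_le (polar_le hDN)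
  have hne : polar N ≠ ⊥ := fun h => hN <| (Ideal.eq_top_iff_one _).2 <| hclosed _ <| by
    rw [h]
    rintro w hw
    rw [(Submodule.mem_bot K).1 hw, map_zero]
  obtain ⟨F, hFE, hF⟩ := exists_isSimpleSubcoalgebra_le hE hne
  refine hF.ne_bot (eq_bot_of_one_mem_perp hF.isSubcoalgebra ?_)
  have hle : coradicalPerp K C ⊔ N ≤ perpIdeal F hF.isSubcoalgebra :=
    sup_le (fun f hf w hw => hf w ((le_sSup hF : F ≤ coradical K C) hw))
      fun f hf w hw => hFE hw f hf
  exact hle ((Ideal.eq_top_iff_one _).1 htop)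

theorem mk_mem_jacobson_of_mem_coradicalPerp {D : Submodule K C} (hD : D.IsSubcoalgebra)
    [FiniteDimensional K D] {f : DualAlgebra K C} (hf : f ∈ coradicalPerp K C) :
    Ideal.Quotient.mk (perpIdeal D hD) f ∈ Ring.jacobson (DualAlgebra K C ⧸ perpIdeal D hD) := by
  have : FiniteDimensional K (DualAlgebra K C ⧸ perpIdeal D hD) :=
    finiteDimensional_quotient (D := D) fun _ h => h
  have : IsArtinianRing (DualAlgebra K C ⧸ perpIdeal D hD) := IsArtinianRing.of_finite K _
  exact Ideal.mk_mem_jacobson_of_forall_sup_ne_top (J := coradicalPerp K C)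
    (fun N _ hle hne => coradicalPerp_sup_ne_top hle hne) hf

theorem exists_mul_one_add_sub_one_mem_perp {D : Submodule K C} (hD : D.IsSubcoalgebra)
    [FiniteDimensional K D] {f : DualAlgebra K C} (hf : f ∈ coradicalPerp K C) :
    ∃ g : DualAlgebra K C, g * (1 + f) - 1 ∈ perp D := by
  have h := mk_mem_jacobson_of_mem_coradicalPerp hD hf
  rw [← Ideal.jacobson_bot, Ideal.mem_jacobson_iff] at h
  obtain ⟨z, hz⟩ := h 1
  obtain ⟨g, rfl⟩ := Ideal.Quotient.mk_surjective z
  refine ⟨g, Ideal.Quotient.eq_zero_iff_mem (I := perpIdeal D hD).1 ?_⟩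
  rw [Ideal.mem_bot, mul_one, ← map_mul, ← map_add, ← map_one (Ideal.Quotient.mk _), ← map_sub] at hz
  rw [mul_add, mul_one, add_comm, hz]

/-- Left inverses modulo D^⊥ exist for each finite-dimensional subcoalgebra D but need not be
compatible. They are used only to show that T(c) = ∑ (1 + f)(c₂) c₁ is injective, since every c lies
in such a D; a linear left inverse of T then yields a global g. -/
theorem exists_mul_one_add_eq_one {f : DualAlgebra K C} (hf : f ∈ coradicalPerp K C) :
    ∃ g : DualAlgebra K C, g * (1 + f) = 1 := by
  let T : C →ₗ[K] C := (_root_.TensorProduct.rid K C).toLinearMap ∘ₗ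
    LinearMap.lTensor C (1 + f).ofConv ∘ₗ comul
  have hT : ∀ (h : DualAlgebra K C) (c : C), h.ofConv (T c) = (h * (1 + f)).ofConv c := by
    intro h c
    have key : h.ofConv ∘ₗ (_root_.TensorProduct.rid K C).toLinearMap ∘ₗ
        LinearMap.lTensor C (1 + f).ofConv =
        LinearMap.mul' K K ∘ₗ _root_.TensorProduct.map h.ofConv (1 + f).ofConv :=
      TensorProduct.ext' fun x y => by simp; ring
    exact LinearMap.congr_fun key (comul c)
  have hinj : LinearMap.ker T = ⊥ := by
    refine (Submodule.eq_bot_iff _).2 fun c hc => ?_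
    obtain ⟨D, hD, hDfin, hcD⟩ := exists_finiteDimensional_isSubcoalgebra (K := K) c
    obtain ⟨g, hg⟩ := exists_mul_one_add_sub_one_mem_perp hD hf
    refine (Module.forall_dual_apply_eq_zero_iff K c).1 fun h => ?_
    let h' : DualAlgebra K C := WithConv.toConv h
    have h1 := mul_mem_perp hD (f := h') (Or.inr hg) c hcD
    have h2 : (h' * g * (1 + f)).ofConv c = 0 := by
      rw [← hT, LinearMap.mem_ker.1 hc, map_zero]
    rw [mul_sub, mul_one, ← mul_assoc] at h1
    change (h' * g * (1 + f)).ofConv c - h c = 0 at h1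
    rw [h2, zero_sub, neg_eq_zero] at h1
    exact h1
  obtain ⟨s, hs⟩ := LinearMap.exists_leftInverse_of_injective T hinj
  -- Since h ∘ T = h(1 + f), taking h = ε ∘ s gives h(1 + f) = ε ∘ s ∘ T = ε, the unit.
  refine ⟨WithConv.toConv (counit ∘ₗ s), WithConv.ext (LinearMap.ext fun c => ?_)⟩
  rw [← hT]
  exact congrArg counit (LinearMap.congr_fun hs c)

theorem mk_mem_jacobson_quotient (I : Ideal (DualAlgebra K C)) [I.IsTwoSided]
    {f : DualAlgebra K C} (hf : f ∈ coradicalPerp K C) :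
    Ideal.Quotient.mk I f ∈ Ideal.jacobson (⊥ : Ideal (DualAlgebra K C ⧸ I)) := by
  refine Ideal.mem_jacobson_iff.2 fun y => ?_
  obtain ⟨y, rfl⟩ := Ideal.Quotient.mk_surjective y
  obtain ⟨g, hg⟩ := exists_mul_one_add_eq_one ((coradicalPerp K C).mul_mem_left y hf)
  refine ⟨Ideal.Quotient.mk I g, ?_⟩
  rw [Ideal.mem_bot, ← map_mul, ← map_mul, ← map_add, ← map_one (Ideal.Quotient.mk I), ← map_sub,
    ← hg, mul_add, mul_one, mul_assoc, add_comm, sub_self, map_zero]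

/-! ### Coreflexivity and restriction to subcoalgebras -/

/-- Restriction of forms to a subcoalgebra, as an algebra homomorphism. -/
noncomputable def restrictHom (D : Submodule K C) [D.IsSubcoalgebra] :
    DualAlgebra K C →ₐ[K] DualAlgebra K D :=
  AlgHom.ofLinearMap
    { toFun := fun f => WithConv.toConv (restrictForm D f)
      map_add' := fun _ _ => rfl
      map_smul' := fun _ _ => rfl } rfl fun f g => by
    refine WithConv.ext (LinearMap.ext fun x => ?_)
    have h := D.mapIncl_subComul x
    change LinearMap.mul' K K (_root_.TensorProduct.map f.ofConv g.ofConv (comul (x : C))) =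
      LinearMap.mul' K K (_root_.TensorProduct.map (restrictForm D f) (restrictForm D g)
        (D.subComul x))
    rw [← h, TensorProduct.mapIncl, _root_.TensorProduct.map_map]
    rfl

theorem restrictHom_eq_zero_iff {D : Submodule K C} [D.IsSubcoalgebra] {f : DualAlgebra K C} :
    restrictHom D f = 0 ↔ f ∈ perp D :=
  ⟨fun h d hd => LinearMap.congr_fun (congrArg WithConv.ofConv h) (⟨d, hd⟩ : D),
    fun h => WithConv.ext (LinearMap.ext fun d => h d d.2)⟩

theorem exists_section_restrictHom (D : Submodule K C) [D.IsSubcoalgebra] :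
    ∃ s : DualAlgebra K D →ₗ[K] DualAlgebra K C, ∀ f, restrictHom D (s f) = f := by
  obtain ⟨s, hs⟩ := exists_extendForm D
  exact ⟨s ∘ₗ (WithConv.linearEquiv K (D →ₗ[K] K)).toLinearMap,
    fun f => WithConv.ext (LinearMap.congr_fun hs f.ofConv)⟩

theorem IsCoreflexive.of_isSubcoalgebra (hC : IsCoreflexive K C) (D : Submodule K C)
    [D.IsSubcoalgebra] : IsCoreflexive K D := by
  obtain ⟨s, hs⟩ := exists_section_restrictHom D
  refine isCoreflexive_iff.2 fun ψ ⟨Q, hQ, hfin, hψ⟩ => ?_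
  obtain ⟨t, ht⟩ := exists_section_quotient (K := K) Q
  obtain ⟨c, hc⟩ := isCoreflexive_iff.1 hC (x := ψ ∘ₗ (restrictHom D).toLinearMap)
    ⟨Q.comap (restrictHom D), inferInstance,
      finiteDimensional_quotient_of_forall_exists (s ∘ₗ t) fun f =>
        ⟨Q.mkQ (restrictHom D f), by
          rw [Ideal.mem_comap, map_sub, LinearMap.comp_apply, hs]
          exact ht _⟩,
      fun f hf => hψ _ hf⟩
  have hcD : c ∈ D := by
    by_contra hcD
    obtain ⟨f, hf, hfc⟩ := exists_mem_perp_apply_ne_zero hcD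
    refine hfc ((LinearMap.congr_fun hc f).trans ?_)
    change ψ (restrictHom D f) = 0
    rw [restrictHom_eq_zero_iff.2 hf, map_zero]
  refine ⟨⟨c, hcD⟩, LinearMap.ext fun h => ?_⟩
  have h1 := LinearMap.congr_fun hc (s h)
  change (s h).ofConv c = ψ (restrictHom D (s h)) at h1
  rw [hs] at h1
  rw [← h1, evalDual_apply]
  conv_lhs => rw [← hs h]
  rfl

/-- As P contains the kernel D^⊥ of restriction, φ descends to D^*, where it kills the image of P, a
cofinite two-sided ideal. This is applied to the coradical. -/
theorem IsCoreflexive.exists_evalDual_eq {D : Submodule K C} [D.IsSubcoalgebra]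
    (hD : IsCoreflexive K D) {P : Ideal (DualAlgebra K C)} [P.IsTwoSided]
    [FiniteDimensional K (DualAlgebra K C ⧸ P)] (hDP : ∀ f ∈ perp D, f ∈ P)
    {φ : Module.Dual K (DualAlgebra K C)} (hφ : ∀ f ∈ P, φ f = 0) :
    ∃ c, evalDual K C c = φ := by
  obtain ⟨s, hs⟩ := exists_section_restrictHom D
  obtain ⟨t, ht⟩ := exists_section_quotient (K := K) P
  have hsP : ∀ f, f - s (restrictHom D f) ∈ P := fun f => hDP _ <| restrictHom_eq_zero_iff.1 <| by
    rw [map_sub, hs, sub_self]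
  have hsurj : Function.Surjective (restrictHom D) := fun h => ⟨s h, hs h⟩
  have hmem : ∀ {h}, h ∈ P.map (restrictHom D) → s h ∈ P := fun {h} hh => by
    obtain ⟨f, hf, rfl⟩ := (Ideal.mem_map_iff_of_surjective _ hsurj).1 hh
    have := P.sub_mem hf (hsP f)
    rwa [sub_sub_cancel] at this
  obtain ⟨c, hc⟩ := isCoreflexive_iff.1 hD (x := φ ∘ₗ s)
    ⟨P.map (restrictHom D), ⟨fun {h} b hh => by
        obtain ⟨f, hf, rfl⟩ := (Ideal.mem_map_iff_of_surjective _ hsurj).1 hh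
        obtain ⟨g, rfl⟩ := hsurj b
        rw [← map_mul]
        exact Ideal.mem_map_of_mem _ (P.mul_mem_right g hf)⟩,
      finiteDimensional_quotient_of_forall_exists ((restrictHom D).toLinearMap ∘ₗ t) fun h =>
        ⟨P.mkQ (s h), by
          have := Ideal.mem_map_of_mem (restrictHom D) (ht (s h))
          rw [map_sub, hs] at this
          exact this⟩,
      fun h hh => hφ _ (hmem hh)⟩
  refine ⟨c, LinearMap.ext fun f => ?_⟩
  have h1 := hφ _ (hsP f)
  rw [map_sub, sub_eq_zero] at h1
  rw [h1]
  exact LinearMap.congr_fun hc (restrictHom D f)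

/-! ### Idempotent orthogonals and the converse -/

theorem perp_le_of_mul_self_eq {I : Ideal (DualAlgebra K C)} [I.IsTwoSided]
    [FiniteDimensional K (DualAlgebra K C ⧸ I)] {U : Submodule K (DualAlgebra K C)}
    (hU : U * U = U) (hle : ∀ f ∈ U, f ∈ I ⊔ coradicalPerp K C) : ∀ f ∈ U, f ∈ I := by
  have : IsArtinianRing (DualAlgebra K C ⧸ I) := IsArtinianRing.of_finite K _
  obtain ⟨n, hn⟩ := IsArtinianRing.isNilpotent_jacobson_bot (R := DualAlgebra K C ⧸ I)
  -- Idempotence of U pushes its image into every power of the radical; exponents start at 1, the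
  -- case given by `hle`.
  have key : ∀ m : ℕ, ∀ f ∈ U, Ideal.Quotient.mk I f ∈
      Ideal.jacobson (⊥ : Ideal (DualAlgebra K C ⧸ I)) ^ (m + 1) := by
    have hone : ∀ f ∈ U, Ideal.Quotient.mk I f ∈
        Ideal.jacobson (⊥ : Ideal (DualAlgebra K C ⧸ I)) := by
      intro f hf
      obtain ⟨a, ha, b, hb, rfl⟩ := Submodule.mem_sup.1 (hle f hf)
      rw [map_add, Ideal.Quotient.eq_zero_iff_mem.2 ha, zero_add]
      exact mk_mem_jacobson_quotient I hb
    intro m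
    induction m with
    | zero => simpa only [zero_add, Submodule.pow_one] using hone
    | succ m ih =>
      intro f hf
      rw [← hU] at hf
      induction hf using Submodule.mul_induction_on' with
      | mem_mul_mem a ha b hb =>
        rw [map_mul, Submodule.pow_succ]
        exact Ideal.mul_mem_mul (ih a ha) (hone b hb)
      | add a _ b _ ha hb =>
        rw [map_add]
        exact Ideal.add_mem _ ha hb
  intro f hf
  have h := Ideal.pow_le_pow_right n.le_succ (key n f hf)
  rw [hn] at h
  exact Ideal.Quotient.eq_zero_iff_mem.1 h

theorem isCoreflexive_of_coradical
    (hC : ∀ V : Submodule K C, V.IsSubcoalgebra → FiniteDimensional K V →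
      ∃ W : Submodule K C, W.IsSubcoalgebra ∧ FiniteDimensional K W ∧ V ≤ W ∧
        perp W * perp W = perp W)
    (h0 : IsCoreflexive K (coradical K C)) : IsCoreflexive K C := by
  refine isCoreflexive_iff.2 fun φ ⟨I, hI, hfin, hφ⟩ => ?_
  let P := I ⊔ coradicalPerp K C
  have hP : P.IsTwoSided := ⟨fun {a} b ha => by
    obtain ⟨x, hx, y, hy, rfl⟩ := Submodule.mem_sup.1 ha
    rw [add_mul]
    exact Submodule.add_mem_sup (I.mul_mem_right b hx)
      ((coradicalPerp K C).mul_mem_right b hy)⟩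
  have hPfin : FiniteDimensional K (DualAlgebra K C ⧸ P) := by
    obtain ⟨t, ht⟩ := exists_section_quotient (K := K) I
    exact finiteDimensional_quotient_of_forall_exists t fun f =>
      ⟨I.mkQ f, (le_sup_left : I ≤ P) (ht f)⟩
  have hclosed : ∀ f ∈ perp (polar P), f ∈ P := fun f hf =>
    mem_of_forall_polar (fun ψ hψ => h0.exists_evalDual_eq (P := P)
      (fun g hg => (le_sup_right : coradicalPerp K C ≤ P) hg) hψ) hf
  obtain ⟨W, -, hWfin, hVW, hWW⟩ := hC (polar P) (isSubcoalgebra_polar P hclosed)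
    (finiteDimensional_polar P)
  have hWI := perp_le_of_mul_self_eq (I := I) hWW fun f hf =>
    hclosed f fun w hw => hf w (hVW hw)
  exact Coalgebra.exists_evalDual_eq (D := W) fun f hf => hφ f (hWI f hf)

end Coalgebra

theorem theorem5p2 {K C : Type*} [Field K] [AddCommGroup C] [Module K C] [Coalgebra K C]
    (hC : ∀ V : Submodule K C, V.IsSubcoalgebra → FiniteDimensional K V →
      ∃ W : Submodule K C, W.IsSubcoalgebra ∧ FiniteDimensional K W ∧ V ≤ W ∧
        Coalgebra.perp W * Coalgebra.perp W = Coalgebra.perp W) :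
    Coalgebra.IsCoreflexive K C ↔ Coalgebra.IsCoreflexive K (Coalgebra.coradical K C) :=
  ⟨fun h => h.of_isSubcoalgebra _, Coalgebra.isCoreflexive_of_coradical hC⟩
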